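/- Let $\mu$ be a nontrivial probability measure on the unit circle (one not carried by finitely many points), let $\phi_n$, $n\ge 0$, be its monic orthogonal polynomials ($\phi_n$ is monic of degree $n$ and $\int \bar z^{\,j}\phi_n(z)\,d\mu(z)=0$ for $0\le j\le n-1$), and let $\alpha_n=-\overline{\phi_{n+1}(0)}$, $n\ge 0$, be its Verblunsky coefficients. Put $\tau_0=1$ and $\tau_n=\tau_{n-1}\dfrac{1-\overline{\tau}_{n-1}\overline{\alpha}_{n-1}}{1-\tau_{n-1}\alpha_{n-1}}$ for $n\ge 1$. A real sequence $\{d_n\}_{n\ge1}$ is a positive chain sequence with minimal parameter sequence $\{m_n\}_{n\ge0}$ if $m_0=0$, $0<m_n<1$ and $d_n=(1-m_{n-1})m_n$ for $n\ge1$. Let $\{c_n\}_{n\ge1}$ be a real sequence and $\{d_n\}_{n\ge1}$ a positive chain sequence with minimal parameter sequence $\{m_n\}_{n\ge0}$, and suppose that $\mu$ is the measure associated with the pair $\{\{c_n\},\{d_n\}\}$, that is, for all $n\ge 1$, $$c_n=\frac{-\operatorname{Im}(\tau_{n-1}\alpha_{n-1})}{1-\operatorname{Re}(\tau_{n-1}\alpha_{n-1})},\qquad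 m_n=\frac12\,\frac{|1-\tau_{n-1}\alpha_{n-1}|^2}{1-\operatorname{Re}(\tau_{n-1}\alpha_{n-1})}.$$ Let $p$ be a positive even integer. Then the following statements are equivalent: (i) The sequences $\{c_n\}_{n\ge1}$ and $\{m_n\}_{n\ge1}$ are $p$-periodic ($c_{n+p}=c_n$ and $m_{n+p}=m_n$ for all $n\ge1$), and $c_{2n}=-c_{2n-1}$ for all $n\ge1$. (ii) The sequence $\{\alpha_n\}_{n\ge0}$ is $p$-periodic ($\alpha_{n+p}=\alpha_n$ for all $n\ge0$), and for each $k\in\{0,1,\dots,\frac{p-2}{2}\}$ the straight line through $\alpha_{2k}$ and $1$ is parallel to the straight line through $\alpha_{2k+1}$ and $-1$ (coinciding lines count as parallel). -/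

import Mathlib

open MeasureTheory Polynomial
open scoped ComplexConjugate Affine

/-- A measure on the unit circle is nontrivial if it is not carried by a finite set of points
(that is, its support is infinite). -/
def IsNontrivialMeasure (μ : Measure (Metric.sphere (0 : ℂ) 1)) : Prop :=
  ∀ s : Set (Metric.sphere (0 : ℂ) 1), s.Finite → μ sᶜ ≠ 0

/-- `φ` is the sequence of monic orthogonal polynomials on the unit circle for `μ`:
`φ n` is monic of degree `n` and `∫ z̄ ^ j φ_n(z) dμ(z) = 0` for `0 ≤ j ≤ n - 1`. -/
def IsMonicOPUC (μ : Measure (Metric.sphere (0 : ℂ) 1)) (φ : ℕ → ℂ[X]) : Prop :=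
  ∀ n : ℕ, (φ n).Monic ∧ (φ n).natDegree = n ∧
    ∀ j : ℕ, j < n → ∫ z : Metric.sphere (0 : ℂ) 1, conj (z : ℂ) ^ j * (φ n).eval (z : ℂ) ∂μ = 0

/-- `α` is the sequence of Verblunsky coefficients of `μ`: `α_n = - conj (φ_{n+1}(0))`, where
`φ_n` are the monic orthogonal polynomials of `μ`. -/
def IsVerblunskySequence (μ : Measure (Metric.sphere (0 : ℂ) 1)) (α : ℕ → ℂ) : Prop :=
  ∃ φ : ℕ → ℂ[X], IsMonicOPUC μ φ ∧ ∀ n : ℕ, α n = -conj ((φ (n + 1)).eval 0)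

/-- The unimodular sequence `τ_0 = 1`,
`τ_n = τ_{n-1} (1 - conj τ_{n-1} conj α_{n-1}) / (1 - τ_{n-1} α_{n-1})`. -/
noncomputable def tauSeq (α : ℕ → ℂ) : ℕ → ℂ
  | 0 => 1
  | n + 1 => tauSeq α n * ((1 - conj (tauSeq α n) * conj (α n)) / (1 - tauSeq α n * α n))

/-- `g = (g_n)_{n ≥ 0}` is a parameter sequence of the positive chain sequence `(d_n)_{n ≥ 1}`:
`0 ≤ g_0 < 1`, `0 < g_n < 1` and `d_n = (1 - g_{n-1}) g_n` for `n ≥ 1`.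
(A real sequence `(d_n)_{n ≥ 1}` is a positive chain sequence when it has such a `g`.
The value `d 0` plays no role.) -/
def IsParameterSequence (d g : ℕ → ℝ) : Prop :=
  0 ≤ g 0 ∧ g 0 < 1 ∧ ∀ n : ℕ, 0 < g (n + 1) ∧ g (n + 1) < 1 ∧ d (n + 1) = (1 - g n) * g (n + 1)

/-- `m` is the minimal parameter sequence of the positive chain sequence `(d_n)_{n ≥ 1}`, the
parameter sequence with `m_0 = 0`. -/
def IsMinimalParameterSequence (d m : ℕ → ℝ) : Prop :=
  IsParameterSequence d m ∧ m 0 = 0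

/-- The measure `μ` and the pair `((c_n)_{n ≥ 1}, (d_n)_{n ≥ 1})` of real sequences, with `d` a
positive chain sequence, are associated with each other: if `α` is the sequence of Verblunsky
coefficients of `μ`, and `m` the minimal parameter sequence of `d`, then for `n ≥ 1`
`c_n = - Im (τ_{n-1} α_{n-1}) / (1 - Re (τ_{n-1} α_{n-1}))` and
`m_n = (1 / 2) |1 - τ_{n-1} α_{n-1}|² / (1 - Re (τ_{n-1} α_{n-1}))`.
Here index `n + 1` stands for `n ≥ 1`; the values `c 0` and `d 0` play no role. -/
def IsAssociatedPair (μ : Measure (Metric.sphere (0 : ℂ) 1)) (c d : ℕ → ℝ) : Prop :=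
  ∃ (α : ℕ → ℂ) (m : ℕ → ℝ), IsVerblunskySequence μ α ∧ IsMinimalParameterSequence d m ∧
    ∀ n : ℕ,
      c (n + 1) = -(tauSeq α n * α n).im / (1 - (tauSeq α n * α n).re) ∧
      m (n + 1) = 1 / 2 * (‖1 - tauSeq α n * α n‖ ^ 2 / (1 - (tauSeq α n * α n).re))

/-! Put w_n = τ_n α_n. On Re w < 1 the pair (c_{n+1}, m_{n+1}) determines w_n, and τ_{n+1} = τ_n
conj(1 - w_n)/(1 - w_n). If τ_{2k} = 1, three conditions are each equivalent to (1 - w_{2k})(1 -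
w_{2k+1}) being real: τ_{2k+2} = 1, c_{2k+2} = -c_{2k+1}, and parallelism of the two lines
(`tauSeq_add_two`, `Complex.neg_im_div_eq_neg_iff`, `line_parallel_iff_of_tauSeq_eq_one`). So either
side forces τ = 1 at all even indices. As p is even, τ_p = 1; then τ is p-periodic, and periodicity
passes between w and α. -/

section OrthogonalPolynomials

/-! ### Uniqueness of the Verblunsky coefficients and of the minimal parameters. -/

theorem IsNontrivialMeasure.eq_zero_of_eval_ae_eq_zero
    {μ : Measure (Metric.sphere (0 : ℂ) 1)} (hμ : IsNontrivialMeasure μ) {q : ℂ[X]}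
    (hq : ∀ᵐ z : Metric.sphere (0 : ℂ) 1 ∂μ, q.eval (z : ℂ) = 0) : q = 0 := by
  by_contra hne
  have hfin : {z : Metric.sphere (0 : ℂ) 1 | q.eval (z : ℂ) = 0}.Finite := by
    have h : (↑q.roots.toFinset : Set ℂ).Finite := Finset.finite_toSet _
    refine (h.preimage (Subtype.val_injective.injOn (s := Set.univ) |>.mono
      (Set.subset_univ _))).subset fun z hz => ?_
    simpa [hne] using hz
  exact hμ _ hfin hq

theorem integrable_of_continuous_sphere {μ : Measure (Metric.sphere (0 : ℂ) 1)}
    [IsFiniteMeasure μ] {f : Metric.sphere (0 : ℂ) 1 → ℂ} (hf : Continuous f) :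
    Integrable f μ := by
  have : CompactSpace (Metric.sphere (0 : ℂ) 1) :=
    isCompact_iff_compactSpace.mp (isCompact_sphere 0 1)
  rw [← integrableOn_univ]
  exact hf.continuousOn.integrableOn_compact isCompact_univ

/-- A polynomial of degree less than `n` that is orthogonal to all `z ^ j`, `j < n`, with respect
to a nontrivial measure is zero. -/
theorem IsNontrivialMeasure.eq_zero_of_orthogonal
    {μ : Measure (Metric.sphere (0 : ℂ) 1)} [IsFiniteMeasure μ] (hμ : IsNontrivialMeasure μ)
    {n : ℕ} {q : ℂ[X]} (hdeg : ∀ j, n ≤ j → q.coeff j = 0)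
    (horth : ∀ j : ℕ, j < n →
      ∫ z : Metric.sphere (0 : ℂ) 1, conj (z : ℂ) ^ j * q.eval (z : ℂ) ∂μ = 0) : q = 0 := by
  have hc : Continuous fun z : Metric.sphere (0 : ℂ) 1 => q.eval (z : ℂ) :=
    q.continuous.comp continuous_subtype_val
  -- Only the conjugated factor is expanded, so ∫ |q|² becomes a combination of the vanishing
  -- integrals.
  have hexp : ∀ z : ℂ, conj (q.eval z) * q.eval z
      = ∑ j ∈ Finset.range n, conj (q.coeff j) * (conj z ^ j * q.eval z) := by
    intro z
    have h : q.eval z = ∑ j ∈ Finset.range n, q.coeff j * z ^ j := by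
      by_cases h0 : q = 0
      · simp [h0]
      · refine Polynomial.eval_eq_sum_range' ?_ z
        by_contra hlt
        exact h0 (Polynomial.leadingCoeff_eq_zero.mp (hdeg _ (not_lt.mp hlt)))
    conv_lhs => rw [h, map_sum, ← h, Finset.sum_mul]
    refine Finset.sum_congr rfl fun j _ => ?_
    rw [map_mul, map_pow]
    ring
  have hzero : ∫ z : Metric.sphere (0 : ℂ) 1, conj (q.eval (z : ℂ)) * q.eval (z : ℂ) ∂μ = 0 := by
    simp_rw [hexp]
    rw [integral_finsetSum]
    · refine Finset.sum_eq_zero fun j hj => ?_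
      rw [integral_const_mul, horth j (Finset.mem_range.mp hj), mul_zero]
    · intro j _
      refine integrable_of_continuous_sphere ?_
      exact continuous_const.mul
        (((Complex.continuous_conj.comp continuous_subtype_val).pow j).mul hc)
  have hreal : ∫ z : Metric.sphere (0 : ℂ) 1, ‖q.eval (z : ℂ)‖ ^ 2 ∂μ = 0 := by
    have h : ∫ z : Metric.sphere (0 : ℂ) 1, ((‖q.eval (z : ℂ)‖ ^ 2 : ℝ) : ℂ) ∂μ = 0 := by
      refine Eq.trans (integral_congr_ae (Filter.Eventually.of_forall fun z => ?_)) hzero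
      simp [Complex.conj_mul']
    exact_mod_cast integral_complex_ofReal.symm.trans h
  have hint : Integrable (fun z : Metric.sphere (0 : ℂ) 1 => ‖q.eval (z : ℂ)‖ ^ 2) μ := by
    have h := (integrable_of_continuous_sphere (μ := μ)
      (f := fun z => ((‖q.eval (z : ℂ)‖ ^ 2 : ℝ) : ℂ))
      (Complex.continuous_ofReal.comp (hc.norm.pow 2))).re
    simpa only [RCLike.re_eq_complex_re, Complex.ofReal_re] using h
  have hae := (integral_eq_zero_iff_of_nonneg (fun z => sq_nonneg _) hint).mp hreal
  refine hμ.eq_zero_of_eval_ae_eq_zero ?_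
  filter_upwards [hae] with z hz
  simpa using hz

theorem IsMonicOPUC.unique {μ : Measure (Metric.sphere (0 : ℂ) 1)} [IsFiniteMeasure μ]
    (hμ : IsNontrivialMeasure μ) {φ ψ : ℕ → ℂ[X]} (hφ : IsMonicOPUC μ φ)
    (hψ : IsMonicOPUC μ ψ) : φ = ψ := by
  funext n
  obtain ⟨hm₁, hd₁, ho₁⟩ := hφ n
  obtain ⟨hm₂, hd₂, ho₂⟩ := hψ n
  refine sub_eq_zero.mp (hμ.eq_zero_of_orthogonal (n := n) (fun j hj => ?_) fun j hj => ?_)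
  · rcases hj.eq_or_lt with rfl | hlt
    · have h₁ := hm₁.coeff_natDegree
      have h₂ := hm₂.coeff_natDegree
      rw [hd₁] at h₁
      rw [hd₂] at h₂
      rw [coeff_sub, h₁, h₂, sub_self]
    · rw [coeff_sub, coeff_eq_zero_of_natDegree_lt (hd₁.trans_lt hlt),
        coeff_eq_zero_of_natDegree_lt (hd₂.trans_lt hlt), sub_self]
  · have hcont : ∀ q : ℂ[X], Continuous fun z : Metric.sphere (0 : ℂ) 1 =>
        conj (z : ℂ) ^ j * q.eval (z : ℂ) := fun q =>
      ((Complex.continuous_conj.comp continuous_subtype_val).pow j).mul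
        (q.continuous.comp continuous_subtype_val)
    simp_rw [eval_sub, mul_sub]
    rw [integral_sub (integrable_of_continuous_sphere (hcont _))
      (integrable_of_continuous_sphere (hcont _)), ho₁ j hj, ho₂ j hj, sub_self]

theorem IsVerblunskySequence.unique {μ : Measure (Metric.sphere (0 : ℂ) 1)} [IsFiniteMeasure μ]
    (hμ : IsNontrivialMeasure μ) {α β : ℕ → ℂ} (hα : IsVerblunskySequence μ α)
    (hβ : IsVerblunskySequence μ β) : α = β := by
  obtain ⟨φ, hφ, h₁⟩ := hα
  obtain ⟨ψ, hψ, h₂⟩ := hβ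
  obtain rfl := hφ.unique hμ hψ
  funext n
  rw [h₁, h₂]

end OrthogonalPolynomials

theorem IsMinimalParameterSequence.unique {d m m' : ℕ → ℝ} (h : IsMinimalParameterSequence d m)
    (h' : IsMinimalParameterSequence d m') : m = m' := by
  have hlt : ∀ n, m n < 1 := by
    rintro (_ | n)
    · exact h.1.2.1
    · exact (h.1.2.2 n).2.1
  funext n
  induction n with
  | zero => rw [h.2, h'.2]
  | succ n ih =>
    have h₁ := (h.1.2.2 n).2.2
    rw [(h'.1.2.2 n).2.2, ← ih] at h₁
    exact (mul_left_cancel₀ (sub_pos.mpr (hlt n)).ne' h₁).symm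

/-! ### Plane geometry of w, c and m. -/

section ComplexLemmas

/-- Positivity of m fixes the sign of 1 - Re w; then m < 1 reads |1 - w|² < 2(1 - Re w), that is
|w|² < 1. -/
theorem Complex.re_lt_one_and_norm_lt_one_of_parameter {w : ℂ} {m : ℝ}
    (hm : m = 1 / 2 * (‖1 - w‖ ^ 2 / (1 - w.re))) (h0 : 0 < m) (h1 : m < 1) :
    w.re < 1 ∧ ‖w‖ < 1 := by
  have hre : w.re < 1 := by
    by_contra hle
    -- This includes Re w = 1, where the quotient is 0 by convention.
    have : ‖1 - w‖ ^ 2 / (1 - w.re) ≤ 0 :=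
      div_nonpos_of_nonneg_of_nonpos (sq_nonneg _) (by linarith)
    linarith
  have hpos : 0 < 1 - w.re := by linarith
  refine ⟨hre, ?_⟩
  have h2 : ‖1 - w‖ ^ 2 < 2 * (1 - w.re) := by
    rw [← div_lt_iff₀ hpos]
    linarith
  rw [Complex.sq_norm, Complex.normSq_apply] at h2
  simp only [Complex.sub_re, Complex.sub_im, Complex.one_re, Complex.one_im] at h2
  have h3 : ‖w‖ ^ 2 < 1 := by
    rw [Complex.sq_norm, Complex.normSq_apply]
    nlinarith
  nlinarith [norm_nonneg w]

/-- The numbers `c` and `m` attached to `w` determine `w`. -/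
theorem Complex.eq_of_parameters_eq {w w' : ℂ} (hw : w.re < 1) (hw' : w'.re < 1)
    (hc : -w.im / (1 - w.re) = -w'.im / (1 - w'.re))
    (hm : 1 / 2 * (‖1 - w‖ ^ 2 / (1 - w.re)) = 1 / 2 * (‖1 - w'‖ ^ 2 / (1 - w'.re))) :
    w = w' := by
  -- This is 2m = (1 - Re v)(1 + c²): c and m give Re v, and then c gives Im v.
  have key : ∀ v : ℂ, v.re < 1 →
      ‖1 - v‖ ^ 2 / (1 - v.re) = (1 - v.re) * (1 + (-v.im / (1 - v.re)) ^ 2) := by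
    intro v hv
    have : 1 - v.re ≠ 0 := by linarith
    rw [Complex.sq_norm, Complex.normSq_apply]
    simp only [Complex.sub_re, Complex.sub_im, Complex.one_re, Complex.one_im]
    field_simp
    ring
  rw [key w hw, key w' hw', hc] at hm
  have hre : 1 - w.re = 1 - w'.re := by
    refine mul_right_cancel₀ (b := 1 + (-w'.im / (1 - w'.re)) ^ 2) (by positivity) ?_
    linarith
  have hne : 1 - w'.re ≠ 0 := by linarith
  rw [hre, div_left_inj' hne] at hc
  exact Complex.ext (by linarith) (by linarith)

theorem Complex.conj_div_self_eq_one_iff {z : ℂ} (hz : z ≠ 0) : conj z / z = 1 ↔ z.im = 0 := by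
  rw [div_eq_one_iff_eq hz, Complex.conj_eq_iff_im]

theorem Complex.span_singleton_eq_iff_im_mul_conj {u v : ℂ} (hu : u ≠ 0) (hv : v ≠ 0) :
    Submodule.span ℝ {u} = Submodule.span ℝ {v} ↔ (v * conj u).im = 0 := by
  rw [Submodule.span_singleton_eq_span_singleton]
  constructor
  · rintro ⟨r, rfl⟩
    simp only [Units.smul_def, Complex.real_smul, mul_assoc, Complex.mul_conj]
    rw [← Complex.ofReal_mul, Complex.ofReal_im]
  · intro h
    have hne : (v * conj u).re ≠ 0 := by
      intro h0
      have : v * conj u = 0 := Complex.ext h0 h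
      simp [hu, hv] at this
    have hn : Complex.normSq u ≠ 0 := by simpa using hu
    refine ⟨Units.mk0 ((v * conj u).re / Complex.normSq u) (div_ne_zero hne hn), ?_⟩
    have hv' : (((v * conj u).re : ℝ) : ℂ) = v * conj u := Complex.ext rfl (by simpa using h.symm)
    have hn' : (Complex.normSq u : ℂ) ≠ 0 := by exact_mod_cast hn
    rw [Units.smul_def, Units.val_mk0, Complex.real_smul, Complex.ofReal_div, hv',
      div_mul_eq_mul_div, div_eq_iff hn', mul_assoc, mul_comm (conj u), Complex.mul_conj]

theorem Complex.line_parallel_iff {a b : ℂ} (ha : a ≠ 1) (hb : b ≠ -1) :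
    line[ℝ, a, (1 : ℂ)] ∥ line[ℝ, b, (-1 : ℂ)] ↔ ((1 + b) * conj (1 - a)).im = 0 := by
  have hv : Submodule.span ℝ {-1 - b} = Submodule.span ℝ {1 + b} := by
    rw [show -1 - b = -(1 + b) by ring, ← Set.neg_singleton, Submodule.span_neg]
  rw [AffineSubspace.affineSpan_pair_parallel_iff_vectorSpan_eq, vectorSpan_pair_rev,
    vectorSpan_pair_rev, vsub_eq_sub, vsub_eq_sub, hv,
    Complex.span_singleton_eq_iff_im_mul_conj (sub_ne_zero.mpr ha.symm)]
  intro h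
  exact hb (by linear_combination h)

theorem Complex.neg_im_div_eq_neg_iff {w w' : ℂ} (hw : w.re < 1) (hw' : w'.re < 1) :
    -w'.im / (1 - w'.re) = -(-w.im / (1 - w.re)) ↔ ((1 - w) * (1 - w')).im = 0 := by
  have h : 1 - w.re ≠ 0 := by linarith
  have h' : 1 - w'.re ≠ 0 := by linarith
  rw [neg_div, neg_inj, div_eq_div_iff h' h]
  simp only [Complex.mul_im, Complex.sub_re, Complex.sub_im, Complex.one_re, Complex.one_im]
  constructor <;> intro H <;> linarith

end ComplexLemmas

/-! ### The sequence τ and periodicity. -/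

section TauSeq

variable {α : ℕ → ℂ}

theorem one_sub_ne_zero_of_re_lt_one {w : ℂ} (hw : w.re < 1) : 1 - w ≠ 0 := by
  intro h
  have := congrArg Complex.re h
  simp only [Complex.sub_re, Complex.one_re, Complex.zero_re] at this
  linarith

theorem tauSeq_succ (α : ℕ → ℂ) (n : ℕ) :
    tauSeq α (n + 1) =
      tauSeq α n * (conj (1 - tauSeq α n * α n) / (1 - tauSeq α n * α n)) := by
  rw [tauSeq, map_sub, map_mul, map_one]

theorem norm_tauSeq (hre : ∀ n, (tauSeq α n * α n).re < 1) (n : ℕ) : ‖tauSeq α n‖ = 1 := by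
  induction n with
  | zero => simp [tauSeq]
  | succ n ih =>
    have h := norm_ne_zero_iff.mpr (one_sub_ne_zero_of_re_lt_one (hre n))
    rw [tauSeq_succ, norm_mul, norm_div, ih, Complex.norm_conj, div_self h, one_mul]

theorem tauSeq_add_of_periodic {p : ℕ} (hτ : tauSeq α p = 1)
    (hw : ∀ n, tauSeq α (n + p) * α (n + p) = tauSeq α n * α n) (n : ℕ) :
    tauSeq α (n + p) = tauSeq α n := by
  induction n with
  | zero => simpa [tauSeq] using hτ
  | succ n ih => rw [Nat.add_right_comm, tauSeq_succ, tauSeq_succ, hw, ih]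

theorem tauSeq_add_of_coeff_periodic {p : ℕ} (hτ : tauSeq α p = 1)
    (hα : ∀ n, α (n + p) = α n) (n : ℕ) : tauSeq α (n + p) = tauSeq α n := by
  induction n with
  | zero => simpa [tauSeq] using hτ
  | succ n ih => rw [Nat.add_right_comm, tauSeq_succ, tauSeq_succ, hα, ih]

theorem tauSeq_add_two (hre : ∀ n, (tauSeq α n * α n).re < 1) {n : ℕ} (hn : tauSeq α n = 1) :
    tauSeq α (n + 2) = 1 ↔
      ((1 - tauSeq α n * α n) * (1 - tauSeq α (n + 1) * α (n + 1))).im = 0 := by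
  have h₀ := one_sub_ne_zero_of_re_lt_one (hre n)
  have h₁ := one_sub_ne_zero_of_re_lt_one (hre (n + 1))
  rw [← Complex.conj_div_self_eq_one_iff (mul_ne_zero h₀ h₁), map_mul, mul_div_mul_comm]
  have h₂ : tauSeq α (n + 1) = conj (1 - tauSeq α n * α n) / (1 - tauSeq α n * α n) := by
    rw [tauSeq_succ, hn, one_mul]
  rw [← h₂, ← tauSeq_succ]

/-- With u = 1 - α_n, the product equals 2 Re u - (1 + α_{n+1}) conj u, and parallelism says that
the last term is real. The bound |α| < 1 keeps both lines nondegenerate. -/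
theorem line_parallel_iff_of_tauSeq_eq_one
    (hlt : ∀ n, ‖α n‖ < 1) {n : ℕ} (hn : tauSeq α n = 1) :
    line[ℝ, α n, (1 : ℂ)] ∥ line[ℝ, α (n + 1), (-1 : ℂ)] ↔
      ((1 - tauSeq α n * α n) * (1 - tauSeq α (n + 1) * α (n + 1))).im = 0 := by
  have ha : α n ≠ 1 := fun h => by simpa [h] using hlt n
  have hb : α (n + 1) ≠ -1 := fun h => by simpa [h] using hlt (n + 1)
  rw [Complex.line_parallel_iff ha hb, tauSeq_succ, hn, one_mul, one_mul]
  have h₀ : 1 - α n ≠ 0 := sub_ne_zero.mpr ha.symm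
  have key : (1 - α n) * (1 - conj (1 - α n) / (1 - α n) * α (n + 1))
      = ((1 - α n) + conj (1 - α n)) - (1 + α (n + 1)) * conj (1 - α n) := by
    field_simp
    ring
  rw [key, Complex.add_conj, Complex.sub_im, Complex.ofReal_im, zero_sub, neg_eq_zero]

/-- The hypothesis is conditional on τ_{2k} = 1 because parallelism yields a real product only once
that is known. -/
theorem tauSeq_two_mul_eq_one (hre : ∀ n, (tauSeq α n * α n).re < 1)
    (h : ∀ k, tauSeq α (2 * k) = 1 →
      ((1 - tauSeq α (2 * k) * α (2 * k)) *
        (1 - tauSeq α (2 * k + 1) * α (2 * k + 1))).im = 0) (k : ℕ) :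
    tauSeq α (2 * k) = 1 := by
  induction k with
  | zero => rfl
  | succ k ih => exact (tauSeq_add_two hre ih).mpr (h k ih)

/-- Periodicity of the pair `(c, m)` with `c (2n) = -c (2n - 1)` corresponds to periodicity of
`α` together with the parallelism conditions. -/
theorem periodic_iff_of_parameters {p : ℕ} (hp : 0 < p) (hpe : Even p) {c m : ℕ → ℝ}
    (hre : ∀ n, (tauSeq α n * α n).re < 1) (hlt : ∀ n, ‖α n‖ < 1)
    (hc : ∀ n, c (n + 1) = -(tauSeq α n * α n).im / (1 - (tauSeq α n * α n).re))
    (hm : ∀ n, m (n + 1) = 1 / 2 * (‖1 - tauSeq α n * α n‖ ^ 2 / (1 - (tauSeq α n * α n).re))) :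
    ((∀ n : ℕ, 1 ≤ n → c (n + p) = c n) ∧
      (∀ n : ℕ, 1 ≤ n → m (n + p) = m n) ∧
      (∀ n : ℕ, 1 ≤ n → c (2 * n) = -c (2 * n - 1))) ↔
    ((∀ n : ℕ, α (n + p) = α n) ∧
      ∀ k : ℕ, k < p / 2 →
        line[ℝ, α (2 * k), (1 : ℂ)] ∥ line[ℝ, α (2 * k + 1), (-1 : ℂ)]) := by
  obtain ⟨q, rfl⟩ := hpe.two_dvd
  have hcneg : ∀ k, c (2 * k + 2) = -c (2 * k + 1) ↔
      ((1 - tauSeq α (2 * k) * α (2 * k)) *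
        (1 - tauSeq α (2 * k + 1) * α (2 * k + 1))).im = 0 := fun k => by
    rw [hc, hc (2 * k), Complex.neg_im_div_eq_neg_iff (hre _) (hre _)]
  constructor
  · rintro ⟨hcp, hmp, hcc⟩
    have him : ∀ k, ((1 - tauSeq α (2 * k) * α (2 * k)) *
        (1 - tauSeq α (2 * k + 1) * α (2 * k + 1))).im = 0 := fun k =>
      (hcneg k).mp (hcc (k + 1) (Nat.le_add_left 1 k))
    have hτ := tauSeq_two_mul_eq_one hre fun k _ => him k
    have hw : ∀ n, tauSeq α (n + 2 * q) * α (n + 2 * q) = tauSeq α n * α n := by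
      intro n
      have h₁ := hcp (n + 1) (Nat.le_add_left 1 n)
      have h₂ := hmp (n + 1) (Nat.le_add_left 1 n)
      rw [Nat.add_right_comm] at h₁ h₂
      rw [hc, hc] at h₁
      rw [hm, hm] at h₂
      exact Complex.eq_of_parameters_eq (hre _) (hre _) h₁ h₂
    refine ⟨fun n => ?_, fun k _ =>
      (line_parallel_iff_of_tauSeq_eq_one hlt (hτ k)).mpr (him k)⟩
    have h := hw n
    rw [tauSeq_add_of_periodic (hτ q) hw] at h
    exact mul_left_cancel₀ (norm_ne_zero_iff.mp (by rw [norm_tauSeq hre]; exact one_ne_zero)) h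
  · rintro ⟨hα, hpar⟩
    have hq : 0 < q := by omega
    have hper : Function.Periodic α (2 * q) := hα
    -- Parallelism is given over one period only; reducing k modulo q shifts the index 2k by a
    -- multiple of 2q.
    have hparall : ∀ k, line[ℝ, α (2 * k), (1 : ℂ)] ∥ line[ℝ, α (2 * k + 1), (-1 : ℂ)] := by
      intro k
      have h := hpar (k % q) (by
        rw [Nat.mul_div_cancel_left q two_pos]
        exact Nat.mod_lt _ hq)
      have hk : 2 * k = 2 * (k % q) + (k / q) * (2 * q) := by
        conv_lhs => rw [← Nat.mod_add_div k q]
        ring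
      have h₀ : α (2 * k) = α (2 * (k % q)) := by
        rw [hk]
        exact hper.nat_mul (k / q) _
      have h₁ : α (2 * k + 1) = α (2 * (k % q) + 1) := by
        rw [hk, Nat.add_right_comm]
        exact hper.nat_mul (k / q) _
      rwa [h₀, h₁]
    have hτ := tauSeq_two_mul_eq_one hre fun k hk =>
      (line_parallel_iff_of_tauSeq_eq_one hlt hk).mp (hparall k)
    have hτp := tauSeq_add_of_coeff_periodic (hτ q) hα
    refine ⟨?_, ?_, ?_⟩
    · rintro (_ | n) hn
      · omega
      · rw [Nat.add_right_comm, hc, hc, hτp, hα]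
    · rintro (_ | n) hn
      · omega
      · rw [Nat.add_right_comm, hm, hm, hτp, hα]
    · rintro (_ | k) hk
      · omega
      · exact (hcneg k).mpr
          ((line_parallel_iff_of_tauSeq_eq_one hlt (hτ k)).mp (hparall k))

end TauSeq

theorem mainTheorem4 (p : ℕ) (hp : 0 < p) (hpe : Even p)
    (μ : Measure (Metric.sphere (0 : ℂ) 1)) [IsProbabilityMeasure μ] (hμ : IsNontrivialMeasure μ)
    (c d m : ℕ → ℝ) (α : ℕ → ℂ)
    (hpair : IsAssociatedPair μ c d)
    (hm : IsMinimalParameterSequence d m)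
    (hα : IsVerblunskySequence μ α) :
    ((∀ n : ℕ, 1 ≤ n → c (n + p) = c n) ∧
      (∀ n : ℕ, 1 ≤ n → m (n + p) = m n) ∧
      (∀ n : ℕ, 1 ≤ n → c (2 * n) = -c (2 * n - 1))) ↔
    ((∀ n : ℕ, α (n + p) = α n) ∧
      ∀ k : ℕ, k < p / 2 →
        line[ℝ, α (2 * k), (1 : ℂ)] ∥ line[ℝ, α (2 * k + 1), (-1 : ℂ)]) := by
  -- The association supplies its own coefficients and parameters; uniqueness identifies them with
  -- the given ones.
  obtain ⟨β, m', hβ, hm', h⟩ := hpair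
  obtain rfl := hα.unique hμ hβ
  obtain rfl := hm.unique hm'
  have hw : ∀ n, (tauSeq α n * α n).re < 1 ∧ ‖tauSeq α n * α n‖ < 1 := fun n =>
    Complex.re_lt_one_and_norm_lt_one_of_parameter (h n).2 (hm.1.2.2 n).1 (hm.1.2.2 n).2.1
  have hre := fun n => (hw n).1
  refine periodic_iff_of_parameters hp hpe hre (fun n => ?_) (fun n => (h n).1) fun n => (h n).2
  simpa [norm_tauSeq hre n] using (hw n).2
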